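/- Let $(M,g)$ be a smooth Lorentzian manifold of dimension $n\ge 2$ and signature $(-,+,\dots,+)$, with Levi-Civita connection $\nabla$. Let $u$ be a smooth vector field with $u^ju_j=-1$, and let $A,B$ be smooth scalar fields with $A\neq 0$ everywhere, such that the perfect-fluid tensor $\mathscr C_{jk}=A\,u_ju_k+B\,g_{jk}$ is Codazzi: $\nabla_i\mathscr C_{jk}=\nabla_j\mathscr C_{ik}$. Write $\dot X=u^k\nabla_kX$, so that $\dot u_k=u^j\nabla_ju_k$ is the acceleration and $\ddot u_k=u^j\nabla_j\dot u_k$; put $\eta=\dot u^k\dot u_k$, and let $\varphi=\frac{1}{n-1}\nabla_ku^k$ be the expansion parameter. Suppose that the acceleration is closed: $\nabla_j\dot u_k=\nabla_k\dot u_j$. Then: (i) Let $(t,\mathbf x)$ be local coordinates on $M$ with values in a product $I\times U$, where $I\subseteq\mathbb R$ is an open interval and $U\subseteq\mathbb R^{n-1}$ is open and connected (both non-empty), that are doubly-twisted and adapted to $u$, i.e. $$ds^2=-b^2(t,\mathbf x)\,dt^2+a^2(t,\mathbf x)\,g^\star_{\mu\nu}(\mathbf x)\,dx^\mu dx^\nu,\qquad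 u_0=-b(t,\mathbf x),\quad u_\mu=0,$$ with smooth functions $a,b>0$ and a smooth Riemannian metric $g^\star$ on $U$. Then there are positive smooth functions $b_1$ on $I$ and $b_2$ on $U$ with $b(t,\mathbf x)=b_1(t)\,b_2(\mathbf x)$ for all $t\in I$, $\mathbf x\in U$. (ii) Everywhere on $M$, $\varphi=-\dot B/A$ and $$\ddot u_k=\eta\,u_k-\varphi\,\dot u_k .$$ -/

import Mathlib

open scoped Manifold ContDiff

noncomputable section

namespace Spacetime

/-- The coordinate space `ℝⁿ`. -/
abbrev Coord (n : ℕ) : Type := EuclideanSpace ℝ (Fin n)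

/-! ### Tensor calculus for component functions on coordinate space

Indexed families of functions on `ℝⁿ`: `G y i j` are the covariant components `g_{ij}` of a metric,
`x of a covector field, `T y i j` those of a tensor field of type `(0,2)`. -/

section Components

variable {n : ℕ}

/-- The partial derivative `∂ᵢ f`. -/
def pd (i : Fin n) (f : Coord n → ℝ) (y : Coord n) : ℝ :=
  fderiv ℝ f y (EuclideanSpace.single i 1)

/-- The Christoffel symbol `Γᵏᵢⱼ = ½ gᵏˡ (∂ᵢ gⱼₗ + ∂ⱼ gᵢₗ - ∂ₗ gᵢⱼ)` of the Levi-Civita connection;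
the arguments are in the order `k i j`. -/
def christoffel (G : Coord n → Matrix (Fin n) (Fin n) ℝ) (k i j : Fin n) (y : Coord n) : ℝ :=
  (1 / 2) * ∑ l, (G y)⁻¹ k l *
    (pd i (fun z => G z j l) y + pd j (fun z => G z i l) y - pd l (fun z => G z i j) y)

/-- `∇ᵢ wₖ = ∂ᵢ wₖ - Γˡᵢₖ wₗ`. -/
def covDeriv₁ (G : Coord n → Matrix (Fin n) (Fin n) ℝ) (w : Coord n → Fin n → ℝ)
    (i k : Fin n) (y : Coord n) : ℝ :=
  pd i (fun z => w z k) y - ∑ l, christoffel G l i k y * w y l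

/-- `∇ᵢ Tⱼₖ = ∂ᵢ Tⱼₖ - Γˡᵢⱼ Tₗₖ - Γˡᵢₖ Tⱼₗ`. -/
def covDeriv₂ (G T : Coord n → Matrix (Fin n) (Fin n) ℝ) (i j k : Fin n) (y : Coord n) : ℝ :=
  pd i (fun z => T z j k) y - ∑ l, christoffel G l i j y * T y l k
    - ∑ l, christoffel G l i k y * T y j l

/-- The contraction `gʲᵏ wⱼ θₖ`. -/
def contr (G : Coord n → Matrix (Fin n) (Fin n) ℝ) (w θ : Coord n → Fin n → ℝ)
    (y : Coord n) : ℝ :=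
  ∑ j, ∑ k, (G y)⁻¹ j k * w y j * θ y k

end Components

/-! ### Lorentzian manifolds -/

section Manifold

variable {d : ℕ} {M : Type*} [TopologicalSpace M] [ChartedSpace (Coord (d + 1)) M]

/-- A coordinate system of `M` (an element of the smooth maximal atlas). -/
abbrev IsCoordinates (e : OpenPartialHomeomorph M (Coord (d + 1))) : Prop :=
  e ∈ IsManifold.maximalAtlas (𝓡 (d + 1)) ∞ M

/-- The coordinate vector field `∂ᵢ` of the coordinate system `e`, at the point with
coordinates `y`. -/
def coordVector (e : OpenPartialHomeomorph M (Coord (d + 1))) (i : Fin (d + 1))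
    (y : Coord (d + 1)) : TangentSpace (𝓡 (d + 1)) (e.symm y) :=
  mfderiv (𝓡 (d + 1)) (𝓡 (d + 1)) e.symm y
    ((NormedSpace.fromTangentSpace y).symm (EuclideanSpace.single i 1))

/-- The components `Tᵢⱼ = T(∂ᵢ, ∂ⱼ)` of a field of bilinear forms. -/
def components₂ (T : ∀ p : M, LinearMap.BilinForm ℝ (TangentSpace (𝓡 (d + 1)) p))
    (e : OpenPartialHomeomorph M (Coord (d + 1))) (y : Coord (d + 1)) :
    Matrix (Fin (d + 1)) (Fin (d + 1)) ℝ :=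
  Matrix.of fun i j => T (e.symm y) (coordVector e i y) (coordVector e j y)

variable (d M) in
/-- A smooth Lorentzian metric of signature `(-,+,…,+)` on the `(d+1)`-dimensional manifold `M`. -/
structure LorentzianMetric where
  /-- the bilinear form on each tangent space -/
  form : ∀ p : M, LinearMap.BilinForm ℝ (TangentSpace (𝓡 (d + 1)) p)
  symm : ∀ (p : M) (v w : TangentSpace (𝓡 (d + 1)) p), form p v w = form p w v
  signature : ∀ p : M, ∃ f : Module.Basis (Fin (d + 1)) ℝ (TangentSpace (𝓡 (d + 1)) p),
    ∀ i j, form p (f i) (f j) = if i = j then (if i = 0 then -1 else 1) else 0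
  smooth : ∀ e : OpenPartialHomeomorph M (Coord (d + 1)), IsCoordinates e →
    ∀ i j, ContDiffOn ℝ ∞ (fun y => components₂ form e y i j) e.target

/-- The metric components `gᵢⱼ` in the coordinates `e`. -/
def LorentzianMetric.comp (g : LorentzianMetric d M)
    (e : OpenPartialHomeomorph M (Coord (d + 1))) :
    Coord (d + 1) → Matrix (Fin (d + 1)) (Fin (d + 1)) ℝ :=
  components₂ g.form e

/-- A symmetric tensor field `C` of type `(0,2)` is Codazzi: `∇ᵢ Cⱼₖ = ∇ⱼ Cᵢₖ`. -/
def IsCodazzi (g : LorentzianMetric d M)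
    (C : ∀ p : M, LinearMap.BilinForm ℝ (TangentSpace (𝓡 (d + 1)) p)) : Prop :=
  (∀ p v w, C p v w = C p w v) ∧
  ∀ e : OpenPartialHomeomorph M (Coord (d + 1)), IsCoordinates e → ∀ y ∈ e.target, ∀ i j k,
    covDeriv₂ (g.comp e) (components₂ C e) i j k y = covDeriv₂ (g.comp e) (components₂ C e) j i k y

/-- The perfect-fluid tensor `Cⱼₖ = A uⱼ uₖ + B gⱼₖ`. -/
def perfectFluid (g : LorentzianMetric d M) (u : ∀ p : M, TangentSpace (𝓡 (d + 1)) p)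
    (A B : M → ℝ) (p : M) : LinearMap.BilinForm ℝ (TangentSpace (𝓡 (d + 1)) p) :=
  A p • LinearMap.BilinForm.linMulLin (g.form p (u p)) (g.form p (u p)) + B p • g.form p

/-- The covariant components `uₖ = g(u, ∂ₖ)`. -/
def lower (g : LorentzianMetric d M) (u : ∀ p : M, TangentSpace (𝓡 (d + 1)) p)
    (e : OpenPartialHomeomorph M (Coord (d + 1))) (y : Coord (d + 1)) (k : Fin (d + 1)) : ℝ :=
  g.form (e.symm y) (u (e.symm y)) (coordVector e k y)

/-- `uⁱ`, the components of the vector field `u` in the coordinates `e`. -/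
def upper (u : ∀ p : M, TangentSpace (𝓡 (d + 1)) p)
    (e : OpenPartialHomeomorph M (Coord (d + 1))) (y : Coord (d + 1)) (i : Fin (d + 1)) : ℝ :=
  NormedSpace.fromTangentSpace _
    (mfderiv (𝓡 (d + 1)) (𝓡 (d + 1)) e (e.symm y) (u (e.symm y))) i

/-- `Ḟ = uᵏ ∂ₖ F` for a scalar field `F`. -/
def dotScalar (u : ∀ p : M, TangentSpace (𝓡 (d + 1)) p)
    (e : OpenPartialHomeomorph M (Coord (d + 1))) (F : M → ℝ) (y : Coord (d + 1)) : ℝ :=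
  ∑ k, upper u e y k * pd k (F ∘ e.symm) y

/-- `ẇₖ = uʲ ∇ⱼ wₖ` for a covector field with components `w` in the coordinates `e`. -/
def dotCovector (g : LorentzianMetric d M) (u : ∀ p : M, TangentSpace (𝓡 (d + 1)) p)
    (e : OpenPartialHomeomorph M (Coord (d + 1))) (w : Coord (d + 1) → Fin (d + 1) → ℝ)
    (y : Coord (d + 1)) (k : Fin (d + 1)) : ℝ :=
  ∑ j, upper u e y j * covDeriv₁ (g.comp e) w j k y

/-- The acceleration `u̇ₖ = uʲ ∇ⱼ uₖ`. -/
def accel (g : LorentzianMetric d M) (u : ∀ p : M, TangentSpace (𝓡 (d + 1)) p)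
    (e : OpenPartialHomeomorph M (Coord (d + 1))) : Coord (d + 1) → Fin (d + 1) → ℝ :=
  dotCovector g u e (lower g u e)

/-- `η = u̇ᵏ u̇ₖ`. -/
def eta (g : LorentzianMetric d M) (u : ∀ p : M, TangentSpace (𝓡 (d + 1)) p)
    (e : OpenPartialHomeomorph M (Coord (d + 1))) : Coord (d + 1) → ℝ :=
  contr (g.comp e) (accel g u e) (accel g u e)

/-- The expansion parameter `φ = ∇ᵏ uₖ / (n - 1)`, where `n = d + 1`. -/
def expansion (g : LorentzianMetric d M) (u : ∀ p : M, TangentSpace (𝓡 (d + 1)) p)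
    (e : OpenPartialHomeomorph M (Coord (d + 1))) (y : Coord (d + 1)) : ℝ :=
  (∑ i, ∑ k, (g.comp e y)⁻¹ i k * covDeriv₁ (g.comp e) (lower g u e) i k y) / d

/-- The acceleration is closed: `∇ⱼ u̇ₖ = ∇ₖ u̇ⱼ`. -/
def HasClosedAcceleration (g : LorentzianMetric d M)
    (u : ∀ p : M, TangentSpace (𝓡 (d + 1)) p) : Prop :=
  ∀ e : OpenPartialHomeomorph M (Coord (d + 1)), IsCoordinates e → ∀ y ∈ e.target, ∀ j k,
    covDeriv₁ (g.comp e) (accel g u e) j k y = covDeriv₁ (g.comp e) (accel g u e) k j y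

/-- The spatial part `x` of coordinates `y = (t, x)`. -/
def spatial (y : Coord (d + 1)) : Coord d := WithLp.toLp 2 fun μ => y μ.succ

/-- The coordinates `e = (t, x)`, with values in the product of an open interval `I` and a connected
open set `U ⊆ ℝᵈ`, are doubly-twisted coordinates adapted to the velocity `u`:
`ds² = -b(t,x)² dt² + a(t,x)² g⋆_{μν}(x) dx^μ dx^ν` with positive smooth `a`, `b` and Riemannian
`g⋆`, and `u₀ = -b`, `u_μ = 0`. -/
structure IsDoublyTwisted (g : LorentzianMetric d M) (u : ∀ p : M, TangentSpace (𝓡 (d + 1)) p)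
    (e : OpenPartialHomeomorph M (Coord (d + 1))) (I : Set ℝ) (U : Set (Coord d))
    (b a : ℝ → Coord d → ℝ) (gs : Coord d → Matrix (Fin d) (Fin d) ℝ) : Prop where
  coordinates : IsCoordinates e
  isOpen_time : IsOpen I
  connected_time : IsConnected I
  isOpen_space : IsOpen U
  connected_space : IsConnected U
  target_eq : e.target = {y | y 0 ∈ I ∧ spatial y ∈ U}
  b_pos : ∀ t ∈ I, ∀ x ∈ U, 0 < b t x
  a_pos : ∀ t ∈ I, ∀ x ∈ U, 0 < a t x
  b_smooth : ContDiffOn ℝ ∞ (fun q : ℝ × Coord d => b q.1 q.2) (I ×ˢ U)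
  a_smooth : ContDiffOn ℝ ∞ (fun q : ℝ × Coord d => a q.1 q.2) (I ×ˢ U)
  gs_smooth : ∀ μ ν, ContDiffOn ℝ ∞ (fun x => gs x μ ν) U
  gs_posDef : ∀ x ∈ U, (gs x).PosDef
  metric_tt : ∀ y ∈ e.target, g.comp e y 0 0 = -(b (y 0) (spatial y)) ^ 2
  metric_tx : ∀ y ∈ e.target, ∀ μ : Fin d, g.comp e y 0 μ.succ = 0
  metric_xx : ∀ y ∈ e.target, ∀ μ ν : Fin d,
    g.comp e y μ.succ ν.succ = (a (y 0) (spatial y)) ^ 2 * gs (spatial y) μ ν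
  velocity_t : ∀ y ∈ e.target, lower g u e y 0 = -b (y 0) (spatial y)
  velocity_x : ∀ y ∈ e.target, ∀ μ : Fin d, lower g u e y μ.succ = 0

end Manifold

end Spacetime

end

namespace Spacetime

/-! ### Tensor calculus in one chart: Leibniz rules, metric compatibility, the contracted Codazzi
identity. -/

section Components

variable {n : ℕ}

/-! Contracting the Codazzi identity of `A u u + B g` once and twice with `u`, using `u·u = -1` and
`uᵏ∇ᵢuₖ = 0`, eliminates the gradient of `A` and leaves `∇ⱼuₖ = φ(gⱼₖ + uⱼuₖ) - uⱼu̇ₖ` with `φ =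
-Ḃ/A` (`gradient_of_codazzi`, `IsCoordinates.covDeriv_lower_eq`). Its metric trace identifies `φ`
with the expansion parameter.

For (ii), differentiate `uᵏu̇ₖ = 0`: `uᵏ∇ⱼu̇ₖ = -u̇ᵏ∇ⱼuₖ = ηuⱼ - φu̇ⱼ` by the gradient formula.
Closedness turns the left side into `uᵏ∇ₖu̇ⱼ = üⱼ`.

For (i), the antisymmetric part of the gradient formula involves only partial derivatives of `uₖ`,
and in adapted coordinates it reads `u̇_μ = ∂_μ log b`, while `u̇₀ = 0` by orthogonality to `u`.
Closedness becomes `∂ₜ∂_μ log b = 0`, so `log b` is a function of time plus a function of space on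
the product of connected domains (`add_eq_add_of_pd_pd_eq_zero`), and `b` factors. -/

theorem pd_congr {i : Fin n} {f h : Coord n → ℝ} {y : Coord n} (hfh : f =ᶠ[nhds y] h) :
    pd i f y = pd i h y := by
  simp only [pd, hfh.fderiv_eq]

theorem pd_const (i : Fin n) (c : ℝ) (y : Coord n) : pd i (fun _ => c) y = 0 := by
  simp [pd]

theorem pd_add (i : Fin n) {f h : Coord n → ℝ} {y : Coord n} (hf : DifferentiableAt ℝ f y)
    (hh : DifferentiableAt ℝ h y) : pd i (fun z => f z + h z) y = pd i f y + pd i h y := by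
  simp [pd, fderiv_fun_add hf hh]

theorem pd_neg (i : Fin n) (f : Coord n → ℝ) (y : Coord n) :
    pd i (fun z => -f z) y = -pd i f y := by
  simp [pd, fderiv_fun_neg]

theorem pd_mul (i : Fin n) {f h : Coord n → ℝ} {y : Coord n} (hf : DifferentiableAt ℝ f y)
    (hh : DifferentiableAt ℝ h y) :
    pd i (fun z => f z * h z) y = pd i f y * h y + f y * pd i h y := by
  simp [pd, fderiv_fun_mul hf hh]; ring

theorem pd_sum (i : Fin n) {ι : Type*} (s : Finset ι) {f : ι → Coord n → ℝ} {y : Coord n}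
    (hf : ∀ l ∈ s, DifferentiableAt ℝ (f l) y) :
    pd i (fun z => ∑ l ∈ s, f l z) y = ∑ l ∈ s, pd i (f l) y := by
  simp [pd, fderiv_fun_sum hf]

variable {G : Coord n → Matrix (Fin n) (Fin n) ℝ}

theorem christoffel_symm (hG : ∀ z i j, G z i j = G z j i) (k i j : Fin n) (y : Coord n) :
    christoffel G k i j y = christoffel G k j i y := by
  simp only [christoffel]
  congr 1
  refine Finset.sum_congr rfl fun l _ => ?_
  simp only [hG _ i j]
  ring

/-- The connection is torsion-free, so the Christoffel terms cancel. Statements about curls thus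
reduce to partial derivatives. -/
theorem covDeriv₁_sub_swap (hG : ∀ z i j, G z i j = G z j i) (w : Coord n → Fin n → ℝ)
    (i k : Fin n) (y : Coord n) :
    covDeriv₁ G w i k y - covDeriv₁ G w k i y =
      pd i (fun z => w z k) y - pd k (fun z => w z i) y := by
  simp only [covDeriv₁, christoffel_symm hG _ k i]
  ring

/-- Lowering the upper index cancels the inverse metric in the definition and leaves the Christoffel
symbols of the first kind. -/
theorem sum_christoffel_mul_metric (hG : ∀ z i j, G z i j = G z j i) {y : Coord n}
    (hdet : IsUnit (G y).det) (i j k : Fin n) :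
    ∑ l, christoffel G l i j y * G y l k =
      (1 / 2) * (pd i (fun z => G z j k) y + pd j (fun z => G z i k) y
        - pd k (fun z => G z i j) y) := by
  have hinv : ∀ m, ∑ l, (G y)⁻¹ l m * G y l k = if k = m then 1 else 0 := by
    intro m
    have h := congrFun (congrFun (Matrix.mul_nonsing_inv _ hdet) k) m
    have hs : ∀ l, (G y)⁻¹ l m * G y l k = G y k l * (G y)⁻¹ l m := fun l => by
      rw [hG y l k]; ring
    simpa only [hs, Matrix.mul_apply, Matrix.one_apply] using h
  simp only [christoffel, Finset.sum_mul, Finset.mul_sum]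
  rw [Finset.sum_comm]
  have : ∀ m, ∑ l, 1 / 2 * ((G y)⁻¹ l m * (pd i (fun z => G z j m) y + pd j (fun z => G z i m) y
      - pd m (fun z => G z i j) y)) * G y l k =
      (if k = m then 1 else 0) * (1 / 2 * (pd i (fun z => G z j m) y + pd j (fun z => G z i m) y
      - pd m (fun z => G z i j) y)) := by
    intro m
    rw [← hinv, Finset.sum_mul]
    exact Finset.sum_congr rfl fun l _ => by ring
  simp only [this, ite_mul, one_mul, zero_mul, Finset.sum_ite_eq, Finset.mem_univ, if_true]

/-- The Levi-Civita connection is compatible with the metric. -/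
theorem pd_metric (hG : ∀ z i j, G z i j = G z j i) {y : Coord n}
    (hdet : IsUnit (G y).det) (i j k : Fin n) :
    pd i (fun z => G z j k) y =
      ∑ l, christoffel G l i j y * G y l k + ∑ l, christoffel G l i k y * G y j l := by
  have h2 := sum_christoffel_mul_metric hG hdet i k j
  simp only [hG y _ j] at h2
  simp only [hG y j]
  rw [sum_christoffel_mul_metric hG hdet i j k]
  simp only [hG y _ j]
  rw [h2]
  simp only [hG _ k j]
  ring

/-- Leibniz rule for the contraction of a vector `v` with a covector `θ = z♭`. -/
theorem pd_contraction (hG : ∀ z i j, G z i j = G z j i) {y : Coord n}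
    (hdet : IsUnit (G y).det) (hGd : ∀ i j, DifferentiableAt ℝ (fun z => G z i j) y)
    {v w θ : Coord n → Fin n → ℝ} {ζ : Fin n → ℝ}
    (hv : ∀ k, DifferentiableAt ℝ (fun z => v z k) y)
    (hθ : ∀ k, DifferentiableAt ℝ (fun z => θ z k) y)
    (hw : ∀ᶠ z in nhds y, ∀ k, w z k = ∑ l, G z k l * v z l)
    (hζ : ∀ k, θ y k = ∑ l, G y k l * ζ l) (i : Fin n) :
    pd i (fun z => ∑ k, v z k * θ z k) y =
      ∑ k, v y k * covDeriv₁ G θ i k y + ∑ k, ζ k * covDeriv₁ G w i k y := by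
  have hD : ∀ k, pd i (fun z => w z k) y =
      ∑ l, (pd i (fun z => G z k l) y * v y l + G y k l * pd i (fun z => v z l) y) := by
    intro k
    rw [pd_congr (hw.mono fun z hz => hz k), pd_sum i _ fun l _ => (hGd k l).fun_mul (hv l)]
    exact Finset.sum_congr rfl fun l _ => pd_mul i (hGd k l) (hv l)
  rw [pd_sum i _ fun l _ => (hv l).fun_mul (hθ l)]
  simp only [fun k => pd_mul i (hv k) (hθ k), covDeriv₁, hD, hw.self_of_nhds, pd_metric hG hdet,
    Finset.sum_add_distrib, mul_sub, Finset.sum_sub_distrib, mul_add, add_mul]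
  -- Here `e1` matches the terms in `∂v`, by symmetry of the metric. The two Christoffel terms of
  -- `∂ᵢgₖₗ` cancel those of `∇w` (`e2`) and of `∇θ` (`e3`). Since `ζ` is never differentiated, it
  -- is needed only at `y`.
  have e1 : ∑ k, pd i (fun z => v z k) y * θ y k =
      ∑ k, ζ k * ∑ l, G y k l * pd i (fun z => v z l) y := by
    simp only [hζ, Finset.mul_sum]
    rw [Finset.sum_comm]
    refine Finset.sum_congr rfl fun k _ => Finset.sum_congr rfl fun l _ => ?_
    rw [hG y l k]; ring
  have e2 : ∑ k, ζ k * ∑ l, (∑ m, christoffel G m i k y * G y m l) * v y l =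
      ∑ k, ζ k * ∑ m, christoffel G m i k y * ∑ l, G y m l * v y l := by
    refine Finset.sum_congr rfl fun k _ => ?_
    simp only [Finset.mul_sum, Finset.sum_mul]
    rw [Finset.sum_comm]
    exact Finset.sum_congr rfl fun m _ => Finset.sum_congr rfl fun l _ => by ring
  have e3 : ∑ k, v y k * ∑ l, christoffel G l i k y * θ y l =
      ∑ k, ζ k * ∑ l, (∑ m, christoffel G m i l y * G y k m) * v y l := by
    simp only [hζ, Finset.mul_sum, Finset.sum_mul]
    rw [Finset.sum_comm]
    rw [Finset.sum_congr rfl fun l _ => Finset.sum_comm]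
    rw [Finset.sum_comm]
    refine Finset.sum_congr rfl fun k _ => ?_
    rw [Finset.sum_comm]
    refine Finset.sum_congr rfl fun m _ => Finset.sum_congr rfl fun l _ => ?_
    rw [hG y l k]; ring
  rw [e1, e2, e3]
  ring

/-- Product rule for `∇(α w w + β g)`; the term `β ∇g` drops out by metric compatibility. -/
theorem covDeriv₂_perfectFluid (hG : ∀ z i j, G z i j = G z j i) {y : Coord n}
    (hdet : IsUnit (G y).det) (hGd : ∀ i j, DifferentiableAt ℝ (fun z => G z i j) y)
    {C : Coord n → Matrix (Fin n) (Fin n) ℝ} {α β : Coord n → ℝ} {w : Coord n → Fin n → ℝ}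
    (hα : DifferentiableAt ℝ α y) (hβ : DifferentiableAt ℝ β y)
    (hw : ∀ k, DifferentiableAt ℝ (fun z => w z k) y)
    (hC : ∀ z j k, C z j k = α z * (w z j * w z k) + β z * G z j k) (i j k : Fin n) :
    covDeriv₂ G C i j k y = pd i α y * w y j * w y k
      + α y * (covDeriv₁ G w i j y * w y k + w y j * covDeriv₁ G w i k y)
      + pd i β y * G y j k := by
  simp only [covDeriv₂, covDeriv₁, hC]
  rw [pd_add i (hα.fun_mul ((hw j).fun_mul (hw k))) (hβ.fun_mul (hGd j k)),
    pd_mul i hα ((hw j).fun_mul (hw k)), pd_mul i hβ (hGd j k), pd_mul i (hw j) (hw k),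
    pd_metric hG hdet]
  have e1 : ∀ j k, ∑ l, christoffel G l i j y * (α y * (w y l * w y k) + β y * G y l k) =
      α y * w y k * ∑ l, christoffel G l i j y * w y l
        + β y * ∑ l, christoffel G l i j y * G y l k := by
    intro j k
    rw [Finset.mul_sum, Finset.mul_sum, ← Finset.sum_add_distrib]
    exact Finset.sum_congr rfl fun l _ => by ring
  have e2 : ∑ l, christoffel G l i k y * (α y * (w y j * w y l) + β y * G y j l) =
      α y * w y j * ∑ l, christoffel G l i k y * w y l
        + β y * ∑ l, christoffel G l i k y * G y j l := by
    rw [Finset.mul_sum, Finset.mul_sum, ← Finset.sum_add_distrib]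
    exact Finset.sum_congr rfl fun l _ => by ring
  rw [e1, e2]
  ring

/-- The algebraic content of the Codazzi condition for a perfect-fluid tensor: the gradient of the
velocity is shear-free and vorticity-free. -/
theorem gradient_of_codazzi {g D : Matrix (Fin n) (Fin n) ℝ} {v w α β : Fin n → ℝ} {a : ℝ}
    (ha : a ≠ 0) (hgs : ∀ i j, g i j = g j i) (hg : ∀ k, w k = ∑ l, v l * g l k) (hvw : ∑ k, v k * w k = -1)
    (hD : ∀ i, ∑ k, v k * D i k = 0)
    (h : ∀ i j k, α i * w j * w k + a * (D i j * w k + w j * D i k) + β i * g j k =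
      α j * w i * w k + a * (D j i * w k + w i * D j k) + β j * g i k) (j k : Fin n) :
    D j k = -(∑ i, v i * β i) / a * (g j k + w j * w k) - w j * ∑ i, v i * D i k := by
  -- The Codazzi identity contracted with `vⁱ`.
  have c1 : ∀ j k, (∑ i, v i * α i) * w j * w k
      + a * ((∑ i, v i * D i j) * w k + w j * ∑ i, v i * D i k) + (∑ i, v i * β i) * g j k =
      -α j * w k - a * D j k + β j * w k := by
    intro j k
    have e1 : ∑ i, v i * (α i * w j * w k + a * (D i j * w k + w j * D i k) + β i * g j k) =
      (∑ i, v i * α i) * w j * w k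
      + a * ((∑ i, v i * D i j) * w k + w j * ∑ i, v i * D i k) + (∑ i, v i * β i) * g j k := by
      simp only [Finset.sum_mul, Finset.mul_sum, ← Finset.sum_add_distrib]
      exact Finset.sum_congr rfl fun i _ => by ring
    have e2 : ∑ i, v i * (α j * w i * w k + a * (D j i * w k + w i * D j k) + β j * g i k) =
      (∑ i, v i * w i) * (α j * w k + a * D j k) + a * w k * (∑ i, v i * D j i)
       + β j * ∑ i, v i * g i k := by
      simp only [Finset.sum_mul, Finset.mul_sum, ← Finset.sum_add_distrib]
      exact Finset.sum_congr rfl fun i _ => by ring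
    rw [← e1, Finset.sum_congr rfl fun i _ => by rw [h i j k], e2, hvw, hD, ← hg]
    ring
  -- The acceleration is orthogonal to the velocity.
  have e0 : ∑ k, v k * ∑ i, v i * D i k = 0 := by
    simp only [Finset.mul_sum]
    rw [Finset.sum_comm]
    refine Finset.sum_eq_zero fun i _ => ?_
    rw [← mul_zero (v i), ← hD i, Finset.mul_sum]
    exact Finset.sum_congr rfl fun k _ => by ring
  -- A second contraction, of `c1` with `vᵏ`. It solves for `αⱼ - βⱼ`; substituted back into `c1`,
  -- it removes every occurrence of `α`.
  have c2 : -(∑ i, v i * α i) * w j - a * (∑ i, v i * D i j) + (∑ i, v i * β i) * w j =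
      α j - β j := by
    have c1j := c1 j
    generalize ∑ i, v i * α i = sα at c1j ⊢
    generalize ∑ i, v i * β i = sβ at c1j ⊢
    generalize ∑ i, v i * D i j = s at c1j ⊢
    have e1 : ∑ k, v k * (sα * w j * w k + a * (s * w k + w j * ∑ i, v i * D i k) + sβ * g j k) =
        (∑ k, v k * w k) * (sα * w j + a * s)
          + a * w j * (∑ k, v k * ∑ i, v i * D i k) + sβ * ∑ k, v k * g k j := by
      rw [Finset.sum_mul, Finset.mul_sum _ _ (a * w j), Finset.mul_sum _ _ sβ,
        ← Finset.sum_add_distrib, ← Finset.sum_add_distrib]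
      exact Finset.sum_congr rfl fun i _ => by rw [hgs j i]; ring
    have e2 : ∑ k, v k * (-α j * w k - a * D j k + β j * w k) =
        (∑ k, v k * w k) * (-α j + β j) - a * ∑ k, v k * D j k := by
      rw [Finset.sum_mul, Finset.mul_sum, ← Finset.sum_sub_distrib]
      exact Finset.sum_congr rfl fun i _ => by ring
    rw [Finset.sum_congr rfl fun k _ => by rw [c1j k], e2, hvw, hD, e0, ← hg] at e1
    linear_combination -e1
  have c1jk := c1 j k
  field_simp
  linear_combination c1jk + w k * c2

/-- The trace of the gradient of a shear-free and vorticity-free velocity. -/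
theorem trace_gradient {g ginv D : Matrix (Fin n) (Fin n) ℝ} {v w s : Fin n → ℝ} {φ : ℝ}
    (hinv : ∑ i, ∑ k, ginv i k * g i k = n) (hginv : ∀ k, ∑ i, ginv i k * w i = v k)
    (hvw : ∑ k, v k * w k = -1) (hvs : ∑ k, v k * s k = 0)
    (h : ∀ j k, D j k = φ * (g j k + w j * w k) - w j * s k) :
    ∑ i, ∑ k, ginv i k * D i k = φ * (n - 1) := by
  have e : ∀ i k, ginv i k * D i k =
      φ * (ginv i k * g i k) + (ginv i k * w i) * (φ * w k - s k) := fun i k => by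
    rw [h]; ring
  have e' : ∑ i, ∑ k, (ginv i k * w i) * (φ * w k - s k) = φ * (∑ k, v k * w k)
      - ∑ k, v k * s k := by
    rw [Finset.sum_comm, Finset.mul_sum, ← Finset.sum_sub_distrib]
    refine Finset.sum_congr rfl fun k _ => ?_
    rw [← Finset.sum_mul, hginv]
    ring
  simp only [e, Finset.sum_add_distrib, e', ← Finset.mul_sum, hinv, hvw, hvs]
  ring

end Components

/-! ### From the manifold to components: coordinate frames, nondegeneracy, raising and lowering,
smoothness. -/

section Manifold

variable {d : ℕ} {M : Type*} [TopologicalSpace M] [ChartedSpace (Coord (d + 1)) M]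

theorem IsCoordinates.mdifferentiable {e : OpenPartialHomeomorph M (Coord (d + 1))}
    (he : IsCoordinates e) : e.MDifferentiable (𝓡 (d + 1)) (𝓡 (d + 1)) :=
  ⟨(contMDiffOn_of_mem_maximalAtlas he).mdifferentiableOn (by simp),
    (contMDiffOn_symm_of_mem_maximalAtlas he).mdifferentiableOn (by simp)⟩

theorem IsCoordinates.contDiffOn_scalar {e : OpenPartialHomeomorph M (Coord (d + 1))}
    (he : IsCoordinates e) {F : M → ℝ} (hF : ContMDiff (𝓡 (d + 1)) 𝓘(ℝ, ℝ) ∞ F) :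
    ContDiffOn ℝ ∞ (F ∘ e.symm) e.target :=
  contMDiffOn_iff_contDiffOn.1
    (hF.comp_contMDiffOn (contMDiffOn_symm_of_mem_maximalAtlas he))

theorem sum_smul_coordVector (e : OpenPartialHomeomorph M (Coord (d + 1))) (y : Coord (d + 1))
    (c : Fin (d + 1) → ℝ) :
    ∑ i, c i • coordVector e i y = mfderiv (𝓡 (d + 1)) (𝓡 (d + 1)) e.symm y
      ((NormedSpace.fromTangentSpace y).symm (WithLp.toLp 2 c)) := by
  have : WithLp.toLp 2 c = ∑ i, c i • EuclideanSpace.single i (1 : ℝ) := by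
    ext j
    simp [Finset.sum_apply, Pi.single_apply]
  rw [this, map_sum, map_sum]
  simp [coordVector]

/-- Every tangent vector is a combination of the coordinate vectors. -/
theorem IsCoordinates.exists_eq_sum {e : OpenPartialHomeomorph M (Coord (d + 1))}
    (he : IsCoordinates e) {y : Coord (d + 1)} (hy : y ∈ e.target)
    (X : TangentSpace (𝓡 (d + 1)) (e.symm y)) :
    X = ∑ i, (NormedSpace.fromTangentSpace _
      (mfderiv (𝓡 (d + 1)) (𝓡 (d + 1)) e (e.symm y) X)) i • coordVector e i y := by
  rw [sum_smul_coordVector]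
  have h := he.mdifferentiable.symm_comp_deriv (e.map_target hy)
  have h' := DFunLike.congr_fun h X
  have hr := e.right_inv hy
  refine h'.symm.trans ?_
  change mfderiv (𝓡 (d + 1)) (𝓡 (d + 1)) e.symm (e (e.symm y)) _ = _
  rw [hr]
  rfl

/-- Linear independence of the coordinate vectors: the differential of `e` is a left inverse of that
of `e.symm`. -/
theorem IsCoordinates.eq_zero_of_sum_eq_zero {e : OpenPartialHomeomorph M (Coord (d + 1))}
    (he : IsCoordinates e) {y : Coord (d + 1)} (hy : y ∈ e.target) {c : Fin (d + 1) → ℝ}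
    (hc : ∑ i, c i • coordVector e i y = 0) : c = 0 := by
  rw [sum_smul_coordVector] at hc
  have h := he.mdifferentiable.comp_symm_deriv hy
  have h' := DFunLike.congr_fun h ((NormedSpace.fromTangentSpace y).symm (WithLp.toLp 2 c))
  have h2 : (NormedSpace.fromTangentSpace (𝕜 := ℝ) y).symm (WithLp.toLp 2 c) = 0 := by
    refine h'.symm.trans ?_
    change mfderiv (𝓡 (d + 1)) (𝓡 (d + 1)) e (e.symm y)
      (mfderiv (𝓡 (d + 1)) (𝓡 (d + 1)) e.symm y _) = 0
    rw [hc, map_zero]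
  have h3 : WithLp.toLp 2 c = (0 : Coord (d + 1)) := by
    simpa using h2
  funext i
  simpa using congrArg (fun z : Coord (d + 1) => z i) h3

/-- Nondegeneracy: pairing with an orthonormal basis vector reads off a coefficient of `X` up to
sign. -/
theorem LorentzianMetric.eq_zero_of_form_eq_zero (g : LorentzianMetric d M) {p : M}
    {X : TangentSpace (𝓡 (d + 1)) p} (h : ∀ v, g.form p v X = 0) : X = 0 := by
  obtain ⟨f, hf⟩ := g.signature p
  rw [← f.sum_repr X]
  refine Finset.sum_eq_zero fun i _ => ?_
  have hi := h (f i)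
  rw [← f.sum_repr X, map_sum] at hi
  simp only [map_smul, hf, smul_eq_mul, mul_ite, mul_zero, Finset.sum_ite_eq, Finset.mem_univ,
    if_true] at hi
  have : f.repr X i = 0 := by
    split_ifs at hi <;> linarith
  rw [this, zero_smul]

theorem LorentzianMetric.comp_symm (g : LorentzianMetric d M)
    (e : OpenPartialHomeomorph M (Coord (d + 1))) (z : Coord (d + 1)) (i j : Fin (d + 1)) :
    g.comp e z i j = g.comp e z j i :=
  g.symm _ _ _

/-- A kernel vector of the component matrix would give a tangent vector orthogonal to all `∂ᵢ`,
hence to every vector, hence zero; independence of the `∂ᵢ` then kills its coefficients. -/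
theorem LorentzianMetric.isUnit_det_comp (g : LorentzianMetric d M)
    {e : OpenPartialHomeomorph M (Coord (d + 1))} (he : IsCoordinates e) {y : Coord (d + 1)}
    (hy : y ∈ e.target) : IsUnit (g.comp e y).det := by
  rw [isUnit_iff_ne_zero]
  intro h0
  obtain ⟨c, hc, hc0⟩ := Matrix.exists_mulVec_eq_zero_iff.2 h0
  refine hc (he.eq_zero_of_sum_eq_zero hy (g.eq_zero_of_form_eq_zero fun v => ?_))
  have key : ∀ i, g.form (e.symm y) (coordVector e i y) (∑ j, c j • coordVector e j y) = 0 := by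
    intro i
    have hi := congrFun hc0 i
    simp only [Matrix.mulVec, dotProduct, Pi.zero_apply] at hi
    rw [map_sum, ← hi]
    refine Finset.sum_congr rfl fun j _ => ?_
    rw [map_smul, smul_eq_mul, mul_comm]
    rfl
  generalize ∑ j, c j • coordVector e j y = X at key
  rw [he.exists_eq_sum hy v, map_sum, LinearMap.sum_apply]
  refine Finset.sum_eq_zero fun i _ => ?_
  rw [map_smul, LinearMap.smul_apply, key, smul_zero]

theorem lower_eq_sum_upper (g : LorentzianMetric d M) (u : ∀ p : M, TangentSpace (𝓡 (d + 1)) p)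
    {e : OpenPartialHomeomorph M (Coord (d + 1))} (he : IsCoordinates e) {y : Coord (d + 1)}
    (hy : y ∈ e.target) (k : Fin (d + 1)) :
    lower g u e y k = ∑ l, g.comp e y k l * upper u e y l := by
  rw [lower, g.symm, he.exists_eq_sum hy (u (e.symm y)), map_sum]
  refine Finset.sum_congr rfl fun l _ => ?_
  rw [map_smul, smul_eq_mul, mul_comm]
  rfl

theorem sum_upper_mul_lower (g : LorentzianMetric d M)
    (u : ∀ p : M, TangentSpace (𝓡 (d + 1)) p)
    {e : OpenPartialHomeomorph M (Coord (d + 1))} (he : IsCoordinates e) {y : Coord (d + 1)}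
    (hy : y ∈ e.target) :
    ∑ k, upper u e y k * lower g u e y k = g.form (e.symm y) (u (e.symm y)) (u (e.symm y)) := by
  have h := congrArg (g.form (e.symm y) (u (e.symm y))) (he.exists_eq_sum hy (u (e.symm y)))
  rw [map_sum] at h
  rw [h]
  refine Finset.sum_congr rfl fun k _ => ?_
  rw [map_smul, smul_eq_mul]
  rfl

theorem sum_inv_mul_lower (g : LorentzianMetric d M)
    (u : ∀ p : M, TangentSpace (𝓡 (d + 1)) p) {e : OpenPartialHomeomorph M (Coord (d + 1))}
    (he : IsCoordinates e) {y : Coord (d + 1)}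
    (hy : y ∈ e.target) (k : Fin (d + 1)) :
    ∑ i, (g.comp e y)⁻¹ i k * lower g u e y i = upper u e y k := by
  have h1 : lower g u e y = Matrix.vecMul (upper u e y) (g.comp e y) := by
    funext k
    rw [lower_eq_sum_upper g u he hy]
    exact Finset.sum_congr rfl fun l _ => by rw [g.comp_symm e y k l, mul_comm]
  have h2 : Matrix.vecMul (lower g u e y) (g.comp e y)⁻¹ = upper u e y := by
    rw [h1, Matrix.vecMul_vecMul, Matrix.mul_nonsing_inv _ (g.isUnit_det_comp he hy),
      Matrix.vecMul_one]
  rw [← h2]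
  exact Finset.sum_congr rfl fun i _ => mul_comm _ _

theorem components₂_perfectFluid (g : LorentzianMetric d M)
    (u : ∀ p : M, TangentSpace (𝓡 (d + 1)) p) (A B : M → ℝ)
    (e : OpenPartialHomeomorph M (Coord (d + 1))) (z : Coord (d + 1)) (j k : Fin (d + 1)) :
    components₂ (perfectFluid g u A B) e z j k =
      (A ∘ e.symm) z * (lower g u e z j * lower g u e z k) + (B ∘ e.symm) z * g.comp e z j k := by
  simp [components₂, perfectFluid, lower, LorentzianMetric.comp]

section

variable [IsManifold (𝓡 (d + 1)) ∞ M]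

/-- The components of `u` are the fibre part of the tangent map of `e` applied to the smooth section
`u ∘ e.symm`, read in the trivial tangent bundle of the model space. -/
theorem IsCoordinates.contDiffOn_upper {e : OpenPartialHomeomorph M (Coord (d + 1))}
    (he : IsCoordinates e) {u : ∀ p : M, TangentSpace (𝓡 (d + 1)) p}
    (hu : ContMDiff (𝓡 (d + 1)) (𝓡 (d + 1)).tangent ∞
      (fun p => (⟨p, u p⟩ : TangentBundle (𝓡 (d + 1)) M))) (i : Fin (d + 1)) :
    ContDiffOn ℝ ∞ (fun y => upper u e y i) e.target := by
  have : IsManifold (𝓡 (d + 1)) 1 M := IsManifold.of_le (n := ∞) (by simp)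
  have h1 := (contMDiffOn_of_mem_maximalAtlas he).contMDiffOn_tangentMapWithin (m := ∞)
    (by simp) e.open_source.uniqueMDiffOn
  have h2 := hu.comp_contMDiffOn (contMDiffOn_symm_of_mem_maximalAtlas he)
  have h3 := (contMDiff_snd_tangentBundle_modelSpace (Coord (d + 1)) (𝓡 (d + 1)) (n := ∞)
    ).comp_contMDiffOn (h1.comp h2 fun y hy => e.map_target hy)
  have h4 := contMDiffOn_iff_contDiffOn.1 h3
  refine ((contDiffOn_piLp 2).1 h4 i).congr fun y hy => ?_
  simp only [upper, Function.comp, tangentMapWithin]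
  rw [mfderivWithin_of_isOpen e.open_source (e.map_target hy)]
  rfl

end

end Manifold

/-! ### Smoothness of the inverse metric and of covariant derivatives. -/

section Components

variable {n : ℕ} {S : Set (Coord n)}

theorem contDiffOn_pd (hS : IsOpen S) {f : Coord n → ℝ} (hf : ContDiffOn ℝ ∞ f S) (i : Fin n) :
    ContDiffOn ℝ ∞ (pd i f) S :=
  (hf.fderiv_of_isOpen (m := ∞) hS (by simp)).clm_apply contDiffOn_const

theorem contDiffOn_det {m : ℕ} {G : Coord n → Matrix (Fin m) (Fin m) ℝ}
    (hG : ∀ i j, ContDiffOn ℝ ∞ (fun y => G y i j) S) :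
    ContDiffOn ℝ ∞ (fun y => (G y).det) S := by
  simp only [Matrix.det_apply]
  exact ContDiffOn.sum fun σ _ => (contDiffOn_prod fun i _ => hG _ _).const_smul _

theorem contDiffOn_inv {m : ℕ} {G : Coord n → Matrix (Fin m) (Fin m) ℝ}
    (hG : ∀ i j, ContDiffOn ℝ ∞ (fun y => G y i j) S) (hdet : ∀ y ∈ S, IsUnit (G y).det)
    (i j : Fin m) : ContDiffOn ℝ ∞ (fun y => (G y)⁻¹ i j) S := by
  simp only [Matrix.inv_def, Ring.inverse_eq_inv', Matrix.smul_apply, smul_eq_mul,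
    Matrix.adjugate_apply]
  refine ((contDiffOn_det hG).inv fun y hy => (hdet y hy).ne_zero).mul (contDiffOn_det ?_)
  intro k l
  -- Cofactor formula: row `j` is replaced by a constant basis vector, the other rows are those of
  -- `G`.
  by_cases h : k = j
  · subst h
    simpa using contDiffOn_const
  · simpa [Matrix.updateRow_ne h] using hG k l

variable {G : Coord n → Matrix (Fin n) (Fin n) ℝ}

theorem contDiffOn_covDeriv₁ (hS : IsOpen S) (hG : ∀ i j, ContDiffOn ℝ ∞ (fun y => G y i j) S)
    (hdet : ∀ y ∈ S, IsUnit (G y).det) {w : Coord n → Fin n → ℝ}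
    (hw : ∀ k, ContDiffOn ℝ ∞ (fun y => w y k) S) (i k : Fin n) :
    ContDiffOn ℝ ∞ (covDeriv₁ G w i k) S := by
  refine (contDiffOn_pd hS (hw k) i).sub (ContDiffOn.sum fun l _ => ContDiffOn.mul ?_ (hw l))
  refine contDiffOn_const.mul (ContDiffOn.sum fun m _ => (contDiffOn_inv hG hdet l m).mul ?_)
  exact ((contDiffOn_pd hS (hG _ _) _).add (contDiffOn_pd hS (hG _ _) _)).sub
    (contDiffOn_pd hS (hG _ _) _)

theorem hasDerivAt_comp_line {f : Coord n → ℝ} {y v : Coord n} {t : ℝ}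
    (hf : DifferentiableAt ℝ f (t • v + y)) :
    HasDerivAt (fun s : ℝ => f (s • v + y)) (fderiv ℝ f (t • v + y) v) t := by
  have h : HasDerivAt (fun s : ℝ => s • v + y) v t := by
    simpa using ((hasDerivAt_id t).smul_const v).add_const y
  exact hf.hasFDerivAt.comp_hasDerivAt t h

end Components

/-! ### Separation of variables on a product of connected domains. -/

section Splitting

variable {d : ℕ}

/-- The inclusion of the space coordinates at time `0`. -/
noncomputable def spaceInclusion (d : ℕ) : Coord d →L[ℝ] Coord (d + 1) :=
  LinearMap.toContinuousLinearMap
    { toFun := fun x => WithLp.toLp 2 (Fin.cons 0 fun μ => x μ)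
      map_add' := fun x x' => by
        ext i
        refine Fin.cases ?_ (fun μ => ?_) i <;> simp
      map_smul' := fun c x => by
        ext i
        refine Fin.cases ?_ (fun μ => ?_) i <;> simp }

/-- The point `(t, x)` of coordinate space. -/
noncomputable def timeSpace (t : ℝ) (x : Coord d) : Coord (d + 1) :=
  t • EuclideanSpace.single 0 1 + spaceInclusion d x

theorem spaceInclusion_zero (x : Coord d) : spaceInclusion d x 0 = 0 := rfl

theorem spaceInclusion_succ (x : Coord d) (μ : Fin d) : spaceInclusion d x μ.succ = x μ := rfl

theorem spaceInclusion_single (μ : Fin d) :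
    spaceInclusion d (EuclideanSpace.single μ 1) = EuclideanSpace.single μ.succ 1 := by
  ext i
  refine Fin.cases ?_ (fun ν => ?_) i
  · simp [spaceInclusion_zero, (Fin.succ_ne_zero μ).symm]
  · simp [spaceInclusion_succ]

@[simp] theorem timeSpace_zero (t : ℝ) (x : Coord d) : timeSpace t x 0 = t := by
  simp [timeSpace, spaceInclusion_zero]

@[simp] theorem spatial_timeSpace (t : ℝ) (x : Coord d) : spatial (timeSpace t x) = x := by
  ext μ
  simp [timeSpace, spatial, spaceInclusion_succ]

theorem contDiff_spatial : ContDiff ℝ ∞ (spatial : Coord (d + 1) → Coord d) :=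
  (contDiff_piLp 2).2 fun μ => contDiff_piLp_apply 2 (i := μ.succ)

/-- A function on a product of connected domains with vanishing mixed partial derivatives is a sum
of a function of time and a function of space. -/
theorem add_eq_add_of_pd_pd_eq_zero {I : Set ℝ} {U : Set (Coord d)} (hI : IsOpen I)
    (hIc : IsPreconnected I) (hU : IsOpen U) (hUc : IsPreconnected U) {f : Coord (d + 1) → ℝ}
    {S : Set (Coord (d + 1))} (hS : IsOpen S) (hIU : S = {y | y 0 ∈ I ∧ spatial y ∈ U})
    (hf : ContDiffOn ℝ ∞ f S) (h : ∀ y ∈ S, ∀ μ : Fin d, pd 0 (pd μ.succ f) y = 0)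
    {t s : ℝ} (ht : t ∈ I) (hs : s ∈ I) {x z : Coord d} (hx : x ∈ U) (hz : z ∈ U) :
    f (timeSpace t x) + f (timeSpace s z) = f (timeSpace t z) + f (timeSpace s x) := by
  have hmem : ∀ t ∈ I, ∀ x ∈ U, timeSpace t x ∈ S := fun t ht x hx => by
    rw [hIU]
    simpa using ⟨ht, hx⟩
  have hd : ∀ y ∈ S, DifferentiableAt ℝ f y := fun y hy =>
    (hf.contDiffAt (hS.mem_nhds hy)).differentiableAt (by simp)
  -- Connectedness of `I`: each spatial derivative of `f` is independent of time.
  have h1 : ∀ x ∈ U, ∀ μ : Fin d, pd μ.succ f (timeSpace t x) = pd μ.succ f (timeSpace s x) := by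
    intro x hx μ
    have hder : ∀ r ∈ I, HasDerivAt (fun r => pd μ.succ f (timeSpace r x)) 0 r := by
      intro r hr
      have hdr : DifferentiableAt ℝ (pd μ.succ f) (timeSpace r x) :=
        ((contDiffOn_pd hS hf μ.succ).contDiffAt
          (hS.mem_nhds (hmem r hr x hx))).differentiableAt (by simp)
      rw [← h _ (hmem r hr x hx) μ]
      exact hasDerivAt_comp_line hdr
    exact hI.is_const_of_deriv_eq_zero hIc
      (fun r hr => (hder r hr).differentiableAt.differentiableWithinAt)
      (fun r hr => (hder r hr).deriv) ht hs
  have h2 : ∀ r ∈ I, ∀ x ∈ U, HasFDerivAt (fun x => f (timeSpace r x))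
      ((fderiv ℝ f (timeSpace r x)).comp (spaceInclusion d)) x := by
    intro r hr x hx
    have e : HasFDerivAt (fun x => timeSpace r x) (spaceInclusion d) x :=
      (spaceInclusion d).hasFDerivAt.const_add _
    exact (hd _ (hmem r hr x hx)).hasFDerivAt.comp x e
  -- Hence the difference of two time slices has zero derivative, and it is constant because `U` is
  -- connected.
  have h3 : ∀ x ∈ U, HasFDerivAt (fun x => f (timeSpace t x) - f (timeSpace s x))
      (0 : Coord d →L[ℝ] ℝ) x := by
    intro x hx
    have h4 : (fderiv ℝ f (timeSpace t x)).comp (spaceInclusion d)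
        = (fderiv ℝ f (timeSpace s x)).comp (spaceInclusion d) := by
      refine ContinuousLinearMap.coe_injective
        ((EuclideanSpace.basisFun _ ℝ).toBasis.ext fun μ => ?_)
      simpa [spaceInclusion_single, pd] using h1 x hx μ
    rw [← sub_eq_zero.2 h4]
    exact (h2 t ht x hx).sub (h2 s hs x hx)
  have := hU.is_const_of_fderiv_eq_zero hUc
    (fun x hx => (h3 x hx).differentiableAt.differentiableWithinAt)
    (fun x hx => (h3 x hx).fderiv) hx hz
  linarith

end Splitting

/-! ### Kinematics of the Codazzi velocity: gradient, expansion and second derivative. -/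

section Manifold

variable {d : ℕ} {M : Type*} [TopologicalSpace M] [ChartedSpace (Coord (d + 1)) M]
  [IsManifold (𝓡 (d + 1)) ∞ M] {g : LorentzianMetric d M}
  {u : ∀ p : M, TangentSpace (𝓡 (d + 1)) p} {e : OpenPartialHomeomorph M (Coord (d + 1))}

theorem IsCoordinates.contDiffOn_lower (he : IsCoordinates e)
    (hu : ContMDiff (𝓡 (d + 1)) (𝓡 (d + 1)).tangent ∞
      (fun p => (⟨p, u p⟩ : TangentBundle (𝓡 (d + 1)) M))) (k : Fin (d + 1)) :
    ContDiffOn ℝ ∞ (fun y => lower g u e y k) e.target :=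
  (ContDiffOn.sum fun l _ => (g.smooth e he k l).mul (he.contDiffOn_upper hu l)).congr
    fun _ hy => lower_eq_sum_upper g u he hy k

theorem IsCoordinates.contDiffOn_accel (he : IsCoordinates e)
    (hu : ContMDiff (𝓡 (d + 1)) (𝓡 (d + 1)).tangent ∞
      (fun p => (⟨p, u p⟩ : TangentBundle (𝓡 (d + 1)) M))) (k : Fin (d + 1)) :
    ContDiffOn ℝ ∞ (fun y => accel g u e y k) e.target := by
  have h : ∀ j, ContDiffOn ℝ ∞ (covDeriv₁ (g.comp e) (lower g u e) j k) e.target := fun j =>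
    contDiffOn_covDeriv₁ e.open_target (g.smooth e he) (fun _ hy => g.isUnit_det_comp he hy)
      (he.contDiffOn_lower hu) j k
  have hs : ContDiffOn ℝ ∞ (fun y => ∑ j, upper u e y j *
      covDeriv₁ (g.comp e) (lower g u e) j k y) e.target :=
    ContDiffOn.sum fun j _ => (he.contDiffOn_upper hu j).mul (h j)
  exact hs

/-- `uᵏ ∇ᵢ θₖ + zᵏ ∇ᵢ uₖ = ∂ᵢ (uᵏ θₖ)` for a covector `θ` with `θₖ = gₖₗ zˡ`. -/
theorem IsCoordinates.pd_upper_contraction (he : IsCoordinates e)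
    (hu : ContMDiff (𝓡 (d + 1)) (𝓡 (d + 1)).tangent ∞
      (fun p => (⟨p, u p⟩ : TangentBundle (𝓡 (d + 1)) M)))
    {y : Coord (d + 1)} (hy : y ∈ e.target) {θ : Coord (d + 1) → Fin (d + 1) → ℝ}
    {ζ : Fin (d + 1) → ℝ} (hθ : ∀ k, ContDiffOn ℝ ∞ (fun y => θ y k) e.target)
    (hζ : ∀ k, θ y k = ∑ l, g.comp e y k l * ζ l) (i : Fin (d + 1)) :
    pd i (fun z => ∑ k, upper u e z k * θ z k) y =
      ∑ k, upper u e y k * covDeriv₁ (g.comp e) θ i k y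
        + ∑ k, ζ k * covDeriv₁ (g.comp e) (lower g u e) i k y := by
  have hn := e.open_target.mem_nhds hy
  refine pd_contraction (g.comp_symm e) (g.isUnit_det_comp he hy)
    (fun i j => ((g.smooth e he i j).contDiffAt hn).differentiableAt (by simp))
    (fun k => ((he.contDiffOn_upper hu k).contDiffAt hn).differentiableAt (by simp))
    (fun k => ((hθ k).contDiffAt hn).differentiableAt (by simp)) ?_ hζ i
  filter_upwards [hn] with z hz k using lower_eq_sum_upper g u he hz k

/-- Differentiating `uᵏuₖ = -1` gives twice this sum. -/
theorem IsCoordinates.sum_upper_mul_covDeriv (he : IsCoordinates e)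
    (hu : ContMDiff (𝓡 (d + 1)) (𝓡 (d + 1)).tangent ∞
      (fun p => (⟨p, u p⟩ : TangentBundle (𝓡 (d + 1)) M)))
    (hunit : ∀ p, g.form p (u p) (u p) = -1) {y : Coord (d + 1)} (hy : y ∈ e.target)
    (i : Fin (d + 1)) :
    ∑ k, upper u e y k * covDeriv₁ (g.comp e) (lower g u e) i k y = 0 := by
  have h := he.pd_upper_contraction (g := g) hu hy (he.contDiffOn_lower hu)
    (lower_eq_sum_upper g u he hy) i
  have h0 : pd i (fun z => ∑ k, upper u e z k * lower g u e z k) y = 0 := by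
    rw [pd_congr (h := fun _ => -1), pd_const]
    filter_upwards [e.open_target.mem_nhds hy] with z hz
    rw [sum_upper_mul_lower g u he hz, hunit]
  rw [h0] at h
  linarith

theorem IsCoordinates.sum_upper_mul_accel (he : IsCoordinates e)
    (hu : ContMDiff (𝓡 (d + 1)) (𝓡 (d + 1)).tangent ∞
      (fun p => (⟨p, u p⟩ : TangentBundle (𝓡 (d + 1)) M)))
    (hunit : ∀ p, g.form p (u p) (u p) = -1) {y : Coord (d + 1)} (hy : y ∈ e.target) :
    ∑ k, upper u e y k * accel g u e y k = 0 := by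
  simp only [accel, dotCovector, Finset.mul_sum]
  rw [Finset.sum_comm]
  refine Finset.sum_eq_zero fun j _ => ?_
  rw [← mul_zero (upper u e y j), ← he.sum_upper_mul_covDeriv hu hunit hy j, Finset.mul_sum]
  exact Finset.sum_congr rfl fun k _ => by ring

/-- The velocity of a Codazzi perfect-fluid tensor is shear-free and vorticity-free:
`∇ⱼ uₖ = φ (gⱼₖ + uⱼ uₖ) - uⱼ u̇ₖ` with `φ = -Ḃ / A`. -/
theorem IsCoordinates.covDeriv_lower_eq (he : IsCoordinates e)
    (hu : ContMDiff (𝓡 (d + 1)) (𝓡 (d + 1)).tangent ∞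
      (fun p => (⟨p, u p⟩ : TangentBundle (𝓡 (d + 1)) M)))
    (hunit : ∀ p, g.form p (u p) (u p) = -1)
    {A B : M → ℝ} (hA : ContMDiff (𝓡 (d + 1)) 𝓘(ℝ, ℝ) ∞ A)
    (hB : ContMDiff (𝓡 (d + 1)) 𝓘(ℝ, ℝ) ∞ B) (hA0 : ∀ p, A p ≠ 0)
    (hC : IsCodazzi g (perfectFluid g u A B)) {y : Coord (d + 1)} (hy : y ∈ e.target)
    (j k : Fin (d + 1)) :
    covDeriv₁ (g.comp e) (lower g u e) j k y =
      -dotScalar u e B y / A (e.symm y) * (g.comp e y j k + lower g u e y j * lower g u e y k)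
        - lower g u e y j * accel g u e y k := by
  have hn := e.open_target.mem_nhds hy
  have key := fun i j k => covDeriv₂_perfectFluid (g.comp_symm e) (g.isUnit_det_comp he hy)
    (fun i j => ((g.smooth e he i j).contDiffAt hn).differentiableAt (by simp))
    (((he.contDiffOn_scalar hA).contDiffAt hn).differentiableAt (by simp))
    (((he.contDiffOn_scalar hB).contDiffAt hn).differentiableAt (by simp))
    (fun k => ((he.contDiffOn_lower (g := g) hu k).contDiffAt hn).differentiableAt (by simp))
    (components₂_perfectFluid g u A B e) i j k
  refine gradient_of_codazzi (D := Matrix.of fun j k => covDeriv₁ (g.comp e) (lower g u e) j k y)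
    (α := fun i => pd i (A ∘ e.symm) y) (hA0 (e.symm y)) (g.comp_symm e y) (fun k => ?_)
    ((sum_upper_mul_lower g u he hy).trans (hunit _))
    (he.sum_upper_mul_covDeriv hu hunit hy) (fun i j k => ?_) j k
  · rw [lower_eq_sum_upper g u he hy k]
    exact Finset.sum_congr rfl fun l _ => by rw [g.comp_symm e y k l, mul_comm]
  · have h := hC.2 e he y hy i j k
    rw [key, key] at h
    exact h

/-- The trace of `g + u u` is `n - 1 = d` and `u·u̇ = 0`; `hd` allows division by `d`. -/
theorem IsCoordinates.expansion_eq (he : IsCoordinates e) (hd : 1 ≤ d)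
    (hu : ContMDiff (𝓡 (d + 1)) (𝓡 (d + 1)).tangent ∞
      (fun p => (⟨p, u p⟩ : TangentBundle (𝓡 (d + 1)) M)))
    (hunit : ∀ p, g.form p (u p) (u p) = -1)
    {φ : ℝ} {y : Coord (d + 1)} (hy : y ∈ e.target)
    (hφ : ∀ j k, covDeriv₁ (g.comp e) (lower g u e) j k y =
      φ * (g.comp e y j k + lower g u e y j * lower g u e y k)
        - lower g u e y j * accel g u e y k) :
    expansion g u e y = φ := by
  have h := trace_gradient (D := Matrix.of fun j k => covDeriv₁ (g.comp e) (lower g u e) j k y)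
    (ginv := (g.comp e y)⁻¹) ?_ (sum_inv_mul_lower g u he hy)
    ((sum_upper_mul_lower g u he hy).trans (hunit _)) (he.sum_upper_mul_accel hu hunit hy) hφ
  · simp only [Matrix.of_apply] at h
    have hd' : (d : ℝ) ≠ 0 := by positivity
    rw [expansion, h]
    push_cast
    field_simp
    ring
  · have h1 := Matrix.nonsing_inv_mul _ (g.isUnit_det_comp he hy)
    have h2 := congrArg Matrix.trace h1
    rw [Matrix.trace_one, Fintype.card_fin] at h2
    rw [← h2]
    simp only [Matrix.trace, Matrix.diag, Matrix.mul_apply]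
    exact Finset.sum_congr rfl fun i _ => Finset.sum_congr rfl fun k _ => by
      rw [g.comp_symm e y i k]

/-- Differentiate `uʲu̇ⱼ = 0` along `∂ₖ`, insert the gradient formula into `u̇ʲ∇ₖuⱼ`, and exchange
the indices of `∇ₖu̇ⱼ` by closedness. Below, `ζ` is the acceleration with raised index. -/
theorem IsCoordinates.dotCovector_accel_eq (he : IsCoordinates e)
    (hu : ContMDiff (𝓡 (d + 1)) (𝓡 (d + 1)).tangent ∞
      (fun p => (⟨p, u p⟩ : TangentBundle (𝓡 (d + 1)) M)))
    (hunit : ∀ p, g.form p (u p) (u p) = -1) (hclosed : HasClosedAcceleration g u)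
    {φ : ℝ} {y : Coord (d + 1)} (hy : y ∈ e.target)
    (hφ : ∀ j k, covDeriv₁ (g.comp e) (lower g u e) j k y =
      φ * (g.comp e y j k + lower g u e y j * lower g u e y k)
        - lower g u e y j * accel g u e y k) (k : Fin (d + 1)) :
    dotCovector g u e (accel g u e) y k =
      eta g u e y * lower g u e y k - φ * accel g u e y k := by
  set ζ := (g.comp e y)⁻¹.mulVec (accel g u e y) with hζdef
  have hζ' : (g.comp e y).mulVec ζ = accel g u e y := by
    rw [hζdef, Matrix.mulVec_mulVec, Matrix.mul_nonsing_inv _ (g.isUnit_det_comp he hy),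
      Matrix.one_mulVec]
  have hζ : ∀ k, accel g u e y k = ∑ l, g.comp e y k l * ζ l := fun k =>
    (congrFun hζ' k).symm
  have h := he.pd_upper_contraction (g := g) hu hy (he.contDiffOn_accel hu) hζ k
  have h0 : pd k (fun z => ∑ k, upper u e z k * accel g u e z k) y = 0 := by
    rw [pd_congr (h := fun _ => 0), pd_const]
    filter_upwards [e.open_target.mem_nhds hy] with z hz
    exact he.sum_upper_mul_accel hu hunit hz
  have hη : eta g u e y = ∑ j, ζ j * accel g u e y j := by
    simp only [eta, contr, hζdef, Matrix.mulVec, dotProduct, Finset.sum_mul]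
    exact Finset.sum_congr rfl fun j _ => Finset.sum_congr rfl fun l _ => by ring
  have hζw : ∑ j, ζ j * lower g u e y j = 0 := by
    rw [← he.sum_upper_mul_accel (g := g) hu hunit hy]
    simp only [hζ, lower_eq_sum_upper g u he hy, Finset.mul_sum]
    rw [Finset.sum_comm]
    exact Finset.sum_congr rfl fun j _ => Finset.sum_congr rfl fun l _ => by
      rw [g.comp_symm e y j l]; ring
  have e1 : ∑ j, ζ j * covDeriv₁ (g.comp e) (lower g u e) k j y =
      φ * (∑ l, g.comp e y k l * ζ l) + φ * lower g u e y k * (∑ j, ζ j * lower g u e y j)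
        - lower g u e y k * ∑ j, ζ j * accel g u e y j := by
    simp only [hφ, Finset.mul_sum, ← Finset.sum_add_distrib, ← Finset.sum_sub_distrib]
    exact Finset.sum_congr rfl fun j _ => by ring
  rw [h0, e1, ← hη, ← hζ, hζw] at h
  rw [dotCovector, Finset.sum_congr rfl fun j _ => by rw [hclosed e he y hy j k]]
  linear_combination -h

end Manifold

/-! ### Doubly-twisted coordinates and the factorization of the lapse. -/

section Manifold

variable {d : ℕ} {M : Type*} [TopologicalSpace M] [ChartedSpace (Coord (d + 1)) M]
  {g : LorentzianMetric d M}
  {u : ∀ p : M, TangentSpace (𝓡 (d + 1)) p} {e : OpenPartialHomeomorph M (Coord (d + 1))}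
  {I : Set ℝ} {U : Set (Coord d)} {b a : ℝ → Coord d → ℝ}
  {gs : Coord d → Matrix (Fin d) (Fin d) ℝ}

namespace IsDoublyTwisted

theorem lapse_pos (h : IsDoublyTwisted g u e I U b a gs) {y : Coord (d + 1)} (hy : y ∈ e.target) :
    0 < b (y 0) (spatial y) := by
  rw [h.target_eq] at hy
  exact h.b_pos _ hy.1 _ hy.2

theorem contDiffOn_lapse (h : IsDoublyTwisted g u e I U b a gs) :
    ContDiffOn ℝ ∞ (fun y : Coord (d + 1) => b (y 0) (spatial y)) e.target := by
  have hc : ContDiff ℝ ∞ (fun y : Coord (d + 1) => (y 0, spatial y)) :=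
    (contDiff_piLp_apply 2 (i := (0 : Fin (d + 1)))).prodMk contDiff_spatial
  refine h.b_smooth.comp hc.contDiffOn fun y hy => ?_
  rw [h.target_eq] at hy
  exact hy

/-- In adapted coordinates the velocity is `b⁻¹ ∂ₜ`. -/
theorem upper_eq (h : IsDoublyTwisted g u e I U b a gs) {y : Coord (d + 1)} (hy : y ∈ e.target) :
    upper u e y = Pi.single 0 (b (y 0) (spatial y))⁻¹ := by
  have hinj := Matrix.mulVec_injective_of_isUnit
    ((Matrix.isUnit_iff_isUnit_det _).2 (g.isUnit_det_comp h.coordinates hy))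
  refine hinj ?_
  have hb := (h.lapse_pos hy).ne'
  funext k
  have hk : (g.comp e y).mulVec (upper u e y) k = lower g u e y k :=
    (lower_eq_sum_upper g u h.coordinates hy k).symm
  rw [hk]
  simp only [Matrix.mulVec_single, Pi.smul_apply, MulOpposite.smul_eq_mul_unop,
    MulOpposite.unop_op, Matrix.col_apply]
  refine Fin.cases ?_ (fun μ => ?_) k
  · rw [h.velocity_t y hy, h.metric_tt y hy]
    field_simp
  · rw [h.velocity_x y hy, g.comp_symm, h.metric_tx y hy, zero_mul]

/-- For a vorticity-free velocity, the acceleration in adapted coordinates is the spatial gradient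
of `log b`. -/
theorem accel_space (h : IsDoublyTwisted g u e I U b a gs)
    {φ : ℝ} {y : Coord (d + 1)} (hy : y ∈ e.target)
    (hφ : ∀ j k, covDeriv₁ (g.comp e) (lower g u e) j k y =
      φ * (g.comp e y j k + lower g u e y j * lower g u e y k)
        - lower g u e y j * accel g u e y k) (μ : Fin d) :
    accel g u e y μ.succ =
      pd μ.succ (fun z : Coord (d + 1) => Real.log (b (z 0) (spatial z))) y := by
  have hn := e.open_target.mem_nhds hy
  have hb := (h.lapse_pos hy).ne'
  -- The `φ` part of the gradient is symmetric, so with `u_μ = 0` the curl of `u` reduces to `u₀u̇_μ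
  -- = ∂_μu₀`, that is `b u̇_μ = ∂_μ b`.
  have h1 := covDeriv₁_sub_swap (g.comp_symm e) (lower g u e) μ.succ 0 y
  have e0 : pd μ.succ (fun z => lower g u e z 0) y =
      -pd μ.succ (fun z : Coord (d + 1) => b (z 0) (spatial z)) y := by
    rw [← pd_neg]
    exact pd_congr (Filter.eventually_of_mem hn h.velocity_t)
  have e1 : pd 0 (fun z => lower g u e z μ.succ) y = 0 := by
    rw [← pd_const 0 0 y]
    exact pd_congr (Filter.eventually_of_mem hn fun z hz => h.velocity_x z hz μ)
  have e2 : pd μ.succ (fun z : Coord (d + 1) => Real.log (b (z 0) (spatial z))) y =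
      (b (y 0) (spatial y))⁻¹ * pd μ.succ (fun z : Coord (d + 1) => b (z 0) (spatial z)) y := by
    have hd := (h.contDiffOn_lapse.contDiffAt hn).differentiableAt (by simp)
    rw [pd, fderiv.log hd hb]
    rfl
  rw [hφ, hφ, e0, e1, g.comp_symm e y 0 μ.succ, h.velocity_x y hy, h.velocity_t y hy] at h1
  rw [e2]
  field_simp
  linear_combination -h1

variable [IsManifold (𝓡 (d + 1)) ∞ M]

/-- The acceleration is orthogonal to `u`, a nonzero multiple of `∂ₜ`. -/
theorem accel_time (h : IsDoublyTwisted g u e I U b a gs)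
    (hu : ContMDiff (𝓡 (d + 1)) (𝓡 (d + 1)).tangent ∞
      (fun p => (⟨p, u p⟩ : TangentBundle (𝓡 (d + 1)) M)))
    (hunit : ∀ p, g.form p (u p) (u p) = -1) {y : Coord (d + 1)} (hy : y ∈ e.target) :
    accel g u e y 0 = 0 := by
  have h0 := h.coordinates.sum_upper_mul_accel hu hunit hy
  rw [h.upper_eq hy] at h0
  simpa [Pi.single_apply, (h.lapse_pos hy).ne'] using h0

/-- A closed acceleration makes the lapse a product of a function of time and a function of
space. -/
theorem lapse_split (h : IsDoublyTwisted g u e I U b a gs)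
    (hu : ContMDiff (𝓡 (d + 1)) (𝓡 (d + 1)).tangent ∞
      (fun p => (⟨p, u p⟩ : TangentBundle (𝓡 (d + 1)) M)))
    (hunit : ∀ p, g.form p (u p) (u p) = -1) (hclosed : HasClosedAcceleration g u)
    {φ : Coord (d + 1) → ℝ}
    (hφ : ∀ y ∈ e.target, ∀ j k, covDeriv₁ (g.comp e) (lower g u e) j k y =
      φ y * (g.comp e y j k + lower g u e y j * lower g u e y k)
        - lower g u e y j * accel g u e y k)
    {t s : ℝ} (ht : t ∈ I) (hs : s ∈ I) {x z : Coord d} (hx : x ∈ U) (hz : z ∈ U) :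
    b t x * b s z = b t z * b s x := by
  have hlog : ContDiffOn ℝ ∞ (fun y : Coord (d + 1) => Real.log (b (y 0) (spatial y))) e.target :=
    h.contDiffOn_lapse.log fun y hy => (h.lapse_pos hy).ne'
  have hmix : ∀ y ∈ e.target, ∀ μ : Fin d,
      pd 0 (pd μ.succ (fun z : Coord (d + 1) => Real.log (b (z 0) (spatial z)))) y = 0 := by
    intro y hy μ
    have hn := e.open_target.mem_nhds hy
    -- Closedness gives `∂ₜu̇_μ = ∂_μu̇₀ = 0`, where `u̇_μ = ∂_μ log b`.
    have h1 := covDeriv₁_sub_swap (g.comp_symm e) (accel g u e) 0 μ.succ y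
    have e1 : pd μ.succ (fun z => accel g u e z 0) y = 0 := by
      rw [← pd_const μ.succ 0 y]
      exact pd_congr (Filter.eventually_of_mem hn fun z hz => h.accel_time hu hunit hz)
    have e2 := pd_congr (i := 0) (Filter.eventually_of_mem hn fun z hz =>
      h.accel_space hz (hφ z hz) μ)
    rw [hclosed e h.coordinates y hy 0 μ.succ, sub_self, e1, e2, sub_zero] at h1
    exact h1.symm
  have key := add_eq_add_of_pd_pd_eq_zero h.isOpen_time h.connected_time.isPreconnected
    h.isOpen_space h.connected_space.isPreconnected e.open_target h.target_eq hlog hmix ht hs hx hz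
  simp only [timeSpace_zero, spatial_timeSpace] at key
  have p := h.b_pos
  rw [← Real.log_mul (p t ht x hx).ne' (p s hs z hz).ne',
    ← Real.log_mul (p t ht z hz).ne' (p s hs x hx).ne'] at key
  exact Real.log_injOn_pos (mul_pos (p t ht x hx) (p s hs z hz))
    (mul_pos (p t ht z hz) (p s hs x hx)) key

end IsDoublyTwisted

end Manifold
end Spacetime

theorem mainTheorem6 {d : ℕ} (hd : 1 ≤ d) {M : Type*} [TopologicalSpace M]
    [ChartedSpace (Spacetime.Coord (d + 1)) M] [IsManifold (𝓡 (d + 1)) ∞ M]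
    (g : Spacetime.LorentzianMetric d M) (u : ∀ p : M, TangentSpace (𝓡 (d + 1)) p)
    (hu : ContMDiff (𝓡 (d + 1)) (𝓡 (d + 1)).tangent ∞
      (fun p => (⟨p, u p⟩ : TangentBundle (𝓡 (d + 1)) M)))
    (hunit : ∀ p, g.form p (u p) (u p) = -1)
    (A B : M → ℝ) (hA : ContMDiff (𝓡 (d + 1)) 𝓘(ℝ, ℝ) ∞ A)
    (hB : ContMDiff (𝓡 (d + 1)) 𝓘(ℝ, ℝ) ∞ B) (hA0 : ∀ p, A p ≠ 0)
    (hC : Spacetime.IsCodazzi g (Spacetime.perfectFluid g u A B))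
    (hclosed : Spacetime.HasClosedAcceleration g u) :
    (∀ (e : OpenPartialHomeomorph M (Spacetime.Coord (d + 1))) (I : Set ℝ)
        (U : Set (Spacetime.Coord d)) (b a : ℝ → Spacetime.Coord d → ℝ)
        (gs : Spacetime.Coord d → Matrix (Fin d) (Fin d) ℝ),
        Spacetime.IsDoublyTwisted g u e I U b a gs →
        ∃ (b₁ : ℝ → ℝ) (b₂ : Spacetime.Coord d → ℝ),
          ContDiffOn ℝ ∞ b₁ I ∧ ContDiffOn ℝ ∞ b₂ U ∧
          (∀ t ∈ I, 0 < b₁ t) ∧ (∀ x ∈ U, 0 < b₂ x) ∧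
          ∀ t ∈ I, ∀ x ∈ U, b t x = b₁ t * b₂ x) ∧
    (∀ e : OpenPartialHomeomorph M (Spacetime.Coord (d + 1)), Spacetime.IsCoordinates e →
        ∀ y ∈ e.target,
          Spacetime.expansion g u e y
            = -Spacetime.dotScalar u e B y / A (e.symm y) ∧
          ∀ k, Spacetime.dotCovector g u e (Spacetime.accel g u e) y k
            = Spacetime.eta g u e y * Spacetime.lower g u e y k
              - Spacetime.expansion g u e y * Spacetime.accel g u e y k) := by
  have hφ : ∀ e, Spacetime.IsCoordinates e → ∀ y ∈ e.target, ∀ j k, _ := fun e he y hy =>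
    Spacetime.IsCoordinates.covDeriv_lower_eq (g := g) (e := e) he hu hunit hA hB hA0 hC hy
  refine ⟨fun e I U b a gs h => ?_, fun e he y hy => ?_⟩
  · obtain ⟨s, hs⟩ := h.connected_time.nonempty
    obtain ⟨z, hz⟩ := h.connected_space.nonempty
    have hsz := h.b_pos s hs z hz
    -- The factors are the slices of `b` through a reference point `(s, z)`; dividing by `b s z`
    -- compensates for counting the value there twice.
    refine ⟨fun t => b t z, fun x => b s x / b s z, ?_, ?_, fun t ht => h.b_pos t ht z hz,
      fun x hx => div_pos (h.b_pos s hs x hx) hsz, fun t ht x hx => ?_⟩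
    · exact h.b_smooth.comp (contDiff_id.prodMk contDiff_const).contDiffOn fun t ht => ⟨ht, hz⟩
    · exact (h.b_smooth.comp (contDiff_const.prodMk contDiff_id).contDiffOn
        fun x hx => ⟨hs, hx⟩).div_const _
    · have := h.lapse_split hu hunit hclosed (hφ e h.coordinates) ht hs hx hz
      field_simp
      exact this
  · have hexp := he.expansion_eq hd hu hunit hy (hφ e he y hy)
    rw [hexp]
    exact ⟨rfl, he.dotCovector_accel_eq hu hunit hclosed hy (hφ e he y hy)⟩
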